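/- **Theorem 4 (Communication cost of ComEx-MPUCB).** *Setting.* There are $K\ge 2$ arms; arm $k$ has a reward distribution $\nu_k$ with mean $\mu_k$ that is sub-Gaussian with variance proxy $\sigma_k^2\le\sigma^2$, where $\sigma>0$ is known. There is a unique best arm, labelled $1$; put $\Delta_k=\mu_1-\mu_k>0$ for $k\ne 1$ and $\bar\Delta=\min_{k\neq 1}\Delta_k$. There are $N$ agents, the vertices of a graph $G$. In each round $t=1,2,\dots$ every agent $i$ pulls an arm $A_t^{(i)}$ and receives a reward $X_t^{(i)}$ drawn from $\nu_{A_t^{(i)}}$, independently of the past and of the rewards of the other agents in that round. *Algorithm (parameters $\xi\ge 1.1$ and an integer $\gamma\ge1$).* Let $N_k^{(i)}(t)$ be the number of observations of arm $k$ available to agent $i$ at the end of round $t$ (its own pulls, and the pulls of other agents reported in messages it has received), and let $\hat\mu_k^{(i)}(t)$ be their average ($0$ if there are none). In round $1$ each agent pulls a random arm (with any distribution). For $t\ge 2$, $A_t^{(i)}$ maximizes $\hat\mu_k^{(i)}(t-1)+C_k^{(i)}(t-1)$ over $k$, where $C_k^{(i)}(t)=\sigma\sqrt{2(\xi+1)\log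 t/N_k^{(i)}(t)}$, and $C_k^{(i)}(t)=\infty$ if $N_k^{(i)}(t)=0$. Agent $i$ initiates the message $\langle i,t,A_t^{(i)},X_t^{(i)}\rangle$ in round $t$ iff $A_t^{(i)}\ne\arg\max_k\hat\mu_k^{(i)}(t-1)$. All ties are broken arbitrarily, possibly at random, but without knowledge of the rewards of the current or later rounds. In each round every agent sends to its neighbours one concatenated message, made up of the message it initiates in this round (if any) and all messages it received in earlier rounds, has not sent before, and whose age (current round minus round of initiation) is at most $\gamma-1$; neighbours receive it in the same round. The cost of a concatenated message is the number of single messages in it, and $L(T)$ is the total cost of all agents over the rounds $1,\dots,T$. *Notation.* $G_r$ is the $r$-th power graph of $G$ (distinct vertices are adjacent iff their distance in $G$ is at most $r$), $d_r^{(i)}$ is the degree of $i$ in $G_r$, $\bar\chi(G_\gamma)$ is the clique covering number of $G_\gamma$, and $$g(M,(x_j)_{j=1}^N)=M+\sum_{j=1}^N\bigl(12\log(3(x_j+1))+3\log(x_j+1)\bigr),$$ with $g(M,x)$, for a single number $x$, meaning that all $x_j$ equal $x$. *Claim.* For every $T\ge1$, $L(T)$ is integrable and $$\mathbb E[L(T)]\le\Bigl[8(\xi+1)\sigma^2\Bigl(\frac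 N{\bar\Delta^2}+\sum_{k\ne1}\frac{\bar\chi(G_\gamma)}{\Delta_k^2}\Bigr)\log T+K\bigl(N-\bar\chi(G_\gamma)\bigr)(\gamma-1)\Bigr]\sum_{i=1}^N\bigl(d_{\gamma-1}^{(i)}+1\bigr)+K\sum_{i=1}^N\bigl(d_{\gamma-1}^{(i)}+1\bigr)\,g\bigl(7N,d_\gamma^{(i)}\bigr),$$ and the same bound holds with the last term replaced by $K\Bigl(\sum_{i=1}^N(d_{\gamma-1}^{(i)}+1)\Bigr)\,g\bigl(7N,(d_\gamma^{(j)})_{j=1}^N\bigr)$. In particular, $\mathbb E[L(T)]=O(\log T)$ as $T\to\infty$. -/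

import Mathlib

open MeasureTheory ProbabilityTheory
open scoped NNReal

/-! ### Graph notions -/

/-- The `r`-th power graph of `G`: two distinct vertices are adjacent iff their distance in `G` is
at most `r` (vertices in different components are at distance `⊤`). -/
def powerGraph {V : Type*} (G : SimpleGraph V) (r : ℕ) : SimpleGraph V where
  Adj i j := i ≠ j ∧ G.edist i j ≤ (r : ℕ∞)
  symm := ⟨fun i j h => ⟨h.1.symm, by rw [SimpleGraph.edist_comm]; exact h.2⟩⟩
  loopless := ⟨fun _ h => h.1 rfl⟩

/-- The degree of `i` in the `r`-th power graph: the number of other agents within distance `r`. -/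
noncomputable def powerDegree {N : ℕ} (G : SimpleGraph (Fin N)) (r : ℕ) (i : Fin N) : ℕ :=
  ((powerGraph G r).neighborSet i).ncard

/-- The clique covering number: the least `n` such that the vertices can be partitioned into `n`
classes (some possibly empty), each of which is a clique. -/
noncomputable def cliqueCoverNumber {V : Type*} (G : SimpleGraph V) : ℕ :=
  sInf {n : ℕ | ∃ f : V → Fin n, ∀ c : Fin n, G.IsClique {v | f v = c}}

/-! ### Message passing

Rounds are numbered `1, 2, 3, …`; the value `0` of a time index is the state before round `1`.
The message `⟨i, t, arm, reward⟩` initiated by agent `i` in round `t` is represented by the pair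
`(i, t)`, which determines its contents. -/

/-- Identifiers `(i, t)` of the messages: initiating agent and round. -/
abbrev MessageId (N : ℕ) : Type := Fin N × ℕ

/-- State of the network at the end of a round. -/
structure NetState (N : ℕ) where
  /-- the concatenated message which the agent sent to its neighbours in this round -/
  outbox : Fin N → Finset (MessageId N)
  /-- all messages the agent has sent so far (own or forwarded) -/
  sent : Fin N → Finset (MessageId N)
  /-- all messages the agent knows so far (initiated by it, or received from a neighbour) -/
  known : Fin N → Finset (MessageId N)

open Classical in
/-- What agent `j` sends in round `t`: the message it initiates in this round, if any, together with
the messages known to it that it has not sent before and whose age is at most `γ - 1`. -/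
noncomputable def outboxStep {N : ℕ} (γ : ℕ) (initiates : ℕ → Fin N → Prop) (t : ℕ)
    (s : NetState N) (j : Fin N) : Finset (MessageId N) :=
  (if initiates t j then {(j, t)} else ∅) ∪
    (s.known j).filter (fun m => m ∉ s.sent j ∧ t < m.2 + γ)

open Classical in
/-- One round of message passing. Messages sent in a round reach the neighbours in that round and
can be forwarded by them from the next round on. -/
noncomputable def netStep {N : ℕ} (G : SimpleGraph (Fin N)) (γ : ℕ)
    (initiates : ℕ → Fin N → Prop) (t : ℕ) (s : NetState N) : NetState N where
  outbox := outboxStep γ initiates t s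
  sent := fun j => s.sent j ∪ outboxStep γ initiates t s j
  known := fun j => s.known j ∪ outboxStep γ initiates t s j ∪
    (Finset.univ.filter (fun l => G.Adj l j)).biUnion (outboxStep γ initiates t s)

/-- The network state at the end of round `t`. -/
noncomputable def netState {N : ℕ} (G : SimpleGraph (Fin N)) (γ : ℕ)
    (initiates : ℕ → Fin N → Prop) : ℕ → NetState N
  | 0 => ⟨fun _ => ∅, fun _ => ∅, fun _ => ∅⟩
  | t + 1 => netStep G γ initiates (t + 1) (netState G γ initiates t)

/-! ### Estimates along one trajectory

`A t i` is the arm pulled by agent `i` in round `t`, `B t i` the arm with maximal estimated mean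
before round `t`, `X t i` the reward received in round `t`. -/

/-- The communication rule: agent `i` initiates a message in round `t` iff the arm it pulls is not
the arm with maximal estimated mean. -/
def initiates {N K : ℕ} (A B : ℕ → Fin N → Fin K) (t : ℕ) (i : Fin N) : Prop :=
  A t i ≠ B t i

/-- Sum of `w t j` over all observations of arm `k` available to agent `i` at the end of round `t`:
all its own pulls, and all pulls of other agents whose message has reached it. -/
noncomputable def observedSum {N K : ℕ} (G : SimpleGraph (Fin N)) (γ : ℕ)
    (A B : ℕ → Fin N → Fin K) (w : ℕ → Fin N → ℝ) (t : ℕ) (i : Fin N) (k : Fin K) : ℝ :=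
  (∑ s ∈ Finset.Icc 1 t, if A s i = k then w s i else 0) +
    ∑ m ∈ (netState G γ (initiates A B) t).known i,
      if m.1 ≠ i ∧ A m.2 m.1 = k then w m.2 m.1 else 0

/-- Number of observations of arm `k` available to agent `i` at the end of round `t`. -/
noncomputable def obsCount {N K : ℕ} (G : SimpleGraph (Fin N)) (γ : ℕ)
    (A B : ℕ → Fin N → Fin K) (t : ℕ) (i : Fin N) (k : Fin K) : ℝ :=
  observedSum G γ A B (fun _ _ => 1) t i k

/-- Empirical mean of the observed rewards of arm `k` (initial value `0` when there are none). -/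
noncomputable def estMean {N K : ℕ} (G : SimpleGraph (Fin N)) (γ : ℕ)
    (A B : ℕ → Fin N → Fin K) (X : ℕ → Fin N → ℝ) (t : ℕ) (i : Fin N) (k : Fin K) : ℝ :=
  if obsCount G γ A B t i k = 0 then 0
  else observedSum G γ A B X t i k / obsCount G γ A B t i k

/-- Upper confidence index of arm `k` for agent `i` at the end of round `t`; it is infinite when
the agent has not yet observed the arm. -/
noncomputable def ucbIndex {N K : ℕ} (G : SimpleGraph (Fin N)) (γ : ℕ) (σ ξ : ℝ)
    (A B : ℕ → Fin N → Fin K) (X : ℕ → Fin N → ℝ) (t : ℕ) (i : Fin N) (k : Fin K) : EReal :=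
  if obsCount G γ A B t i k = 0 then ⊤
  else ((estMean G γ A B X t i k +
    σ * Real.sqrt (2 * (ξ + 1) * Real.log t / obsCount G γ A B t i k) : ℝ) : EReal)

/-! ### The stochastic process -/

/-- A group of `N` agents following ComEx-MPUCB on the `K`-armed bandit with reward distributions
`ν k`, communication graph `G`, density parameter `γ`, and index parameters `σ`, `ξ`. The arms of
the first round are arbitrary random arms; ties are broken arbitrarily, possibly at random. -/
structure ComExMPUCB {N K : ℕ} (G : SimpleGraph (Fin N)) (γ : ℕ) (σ ξ : ℝ)
    (ν : Fin K → Measure ℝ) {Ω : Type*} [mΩ : MeasurableSpace Ω] (P : Measure Ω) where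
  /-- `info t`: everything that has happened up to the end of round `t`, including the
  randomisation used for choosing arms in round `t + 1` -/
  info : Filtration ℕ mΩ
  /-- `draw t i k`: the reward that agent `i` gets in round `t` if it pulls arm `k` -/
  draw : ℕ → Fin N → Fin K → Ω → ℝ
  /-- `arm t i`: the arm pulled by agent `i` in round `t` -/
  arm : ℕ → Fin N → Ω → Fin K
  /-- `greedy t i`: the arm with maximal estimated mean before round `t` -/
  greedy : ℕ → Fin N → Ω → Fin K
  draw_measurable : ∀ t i k, Measurable[info (t + 1)] (draw (t + 1) i k)
  draw_law : ∀ t i k, P.map (draw (t + 1) i k) = ν k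
  /-- within a round, the draws of different agents and arms are independent -/
  draw_indep : ∀ t, iIndepFun (fun p : Fin N × Fin K => draw (t + 1) p.1 p.2) P
  /-- the draws of a round are jointly independent of the past -/
  draw_indep_past : ∀ t,
    Indep (⨆ p : Fin N × Fin K, MeasurableSpace.comap (draw (t + 1) p.1 p.2) inferInstance)
      (info t) P
  arm_measurable : ∀ t i, Measurable[info t] (arm (t + 1) i)
  greedy_measurable : ∀ t i, Measurable[info t] (greedy (t + 1) i)
  /-- from the second round on, an arm of maximal index is pulled -/
  arm_max : ∀ ω t i k, 1 ≤ t →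
    ucbIndex G γ σ ξ (fun s j => arm s j ω) (fun s j => greedy s j ω)
        (fun s j => draw s j (arm s j ω) ω) t i k ≤
      ucbIndex G γ σ ξ (fun s j => arm s j ω) (fun s j => greedy s j ω)
        (fun s j => draw s j (arm s j ω) ω) t i (arm (t + 1) i ω)
  greedy_max : ∀ ω t i k,
    estMean G γ (fun s j => arm s j ω) (fun s j => greedy s j ω)
        (fun s j => draw s j (arm s j ω) ω) t i k ≤
      estMean G γ (fun s j => arm s j ω) (fun s j => greedy s j ω)
        (fun s j => draw s j (arm s j ω) ω) t i (greedy (t + 1) i ω)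

/-- The group communication cost `L(T)`: the total number of single messages contained in the
concatenated messages sent by all agents in the rounds `1, …, T`. -/
noncomputable def ComExMPUCB.commCost {N K : ℕ} {G : SimpleGraph (Fin N)} {γ : ℕ} {σ ξ : ℝ}
    {ν : Fin K → Measure ℝ} {Ω : Type*} [MeasurableSpace Ω] {P : Measure Ω}
    (run : ComExMPUCB G γ σ ξ ν P) (T : ℕ) (ω : Ω) : ℝ :=
  ∑ t ∈ Finset.Icc 1 T, ∑ i : Fin N,
    (((netState G γ (initiates (fun s j => run.arm s j ω) (fun s j => run.greedy s j ω)) t).outbox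
      i).card : ℝ)

/-! ### The bound -/

/-- `g(M, x) = M + ∑ⱼ (12 log (3 (xⱼ + 1)) + 3 log (xⱼ + 1))`; a number `x` is entered as the
constant family. -/
noncomputable def gFun {N : ℕ} (M : ℝ) (x : Fin N → ℝ) : ℝ :=
  M + ∑ j : Fin N, (12 * Real.log (3 * (x j + 1)) + 3 * Real.log (x j + 1))

/-- The smallest gap `min_{k ≠ best} (μ best - μ k)`. -/
noncomputable def minGap {K : ℕ} (μ : Fin K → ℝ) (best : Fin K) : ℝ :=
  ⨅ k : {k : Fin K // k ≠ best}, (μ best - μ k)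

/-- The first (logarithmic) term of the bound. -/
noncomputable def mainTerm {N K : ℕ} (G : SimpleGraph (Fin N)) (γ : ℕ) (σ ξ : ℝ)
    (μ : Fin K → ℝ) (best : Fin K) (T : ℕ) : ℝ :=
  (8 * (ξ + 1) * σ ^ 2 *
      ((N : ℝ) / minGap μ best ^ 2 +
        ∑ k ∈ Finset.univ.erase best,
          (cliqueCoverNumber (powerGraph G γ) : ℝ) / (μ best - μ k) ^ 2) * Real.log T +
    (K : ℝ) * (((N : ℝ) - (cliqueCoverNumber (powerGraph G γ) : ℝ)) * ((γ : ℝ) - 1))) *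
  ∑ i : Fin N, ((powerDegree G (γ - 1) i : ℝ) + 1)

/-! ### Message passing -/

section Network

variable {N : ℕ} (G : SimpleGraph (Fin N)) (γ : ℕ)

/-! No agent sends a message twice, and a message is sent only by agents within distance γ - 1 of
its initiator. So L(T) is at most the sum over j of (d_{γ-1}^{(j)} + 1) times the number of messages
initiated by j (`sum_card_sent_le`), and it remains to bound the initiations of one agent.

If agent i pulls an arm k that is not greedy while its one-sided confidence bounds hold (upper for
suboptimal arms, lower for the best one), then i has at most 8(ξ+1)σ² log T / Δ² observations of k.
Here Δ is the gap of k, or the smallest gap when k is best, since the greedy arm is then suboptimal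
(`obsCount_le_of_initiates`). Its own pulls are among these observations, so each arm accounts for
at most one more than this number of rounds (`initCount_le`).

For the failures, the route of a message does not depend on the rewards. Which pulls are observed is
therefore predictable, and an exponential supermartingale (`lintegral_exp_observed_le`) with a union
bound over the number of observations gives failure probability at most N s^{-ξ}. As ξ ≥ 1.1, these
sum to at most 11 N K per agent.

Cooperation is never exploited: each agent is bounded separately, and N ≥ 1, χ̄ ≥ 1 and `gFun` ≥ 19
N absorb all constants. -/

lemma mem_outboxStep {γ : ℕ} {a : ℕ → Fin N → Prop} {t : ℕ} {s : NetState N} {i : Fin N}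
    {m : MessageId N} :
    m ∈ outboxStep γ a t s i ↔
      (a t i ∧ m = (i, t)) ∨ (m ∈ s.known i ∧ m ∉ s.sent i ∧ t < m.2 + γ) := by
  classical
  unfold outboxStep
  split_ifs with h <;> simp [h]

lemma mem_sent_netStep {a : ℕ → Fin N → Prop} {t : ℕ} {s : NetState N} {i : Fin N}
    {m : MessageId N} :
    m ∈ (netStep G γ a t s).sent i ↔ m ∈ s.sent i ∨ m ∈ outboxStep γ a t s i := by
  classical
  simp [netStep]

lemma mem_known_netStep {a : ℕ → Fin N → Prop} {t : ℕ} {s : NetState N} {i : Fin N}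
    {m : MessageId N} :
    m ∈ (netStep G γ a t s).known i ↔
      m ∈ s.known i ∨ m ∈ outboxStep γ a t s i ∨ ∃ l, G.Adj l i ∧ m ∈ outboxStep γ a t s l := by
  classical
  simp [netStep]

/-- A known message was initiated, in an earlier round, by an agent close enough. -/
lemma netState_known_spec (a : ℕ → Fin N → Prop) (t : ℕ) :
    ∀ i, ∀ m ∈ (netState G γ a t).known i,
      1 ≤ m.2 ∧ m.2 ≤ t ∧ a m.2 m.1 ∧ G.edist m.1 i ≤ ((t + 1 - m.2 : ℕ) : ℕ∞) := by
  induction t with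
  | zero => intro i m hm; simp [netState] at hm
  | succ t ih =>
    -- A message sent in this round is new or was known a round earlier, so its distance bound is
    -- one hop better than the one required of known messages. Delivery to a neighbour uses up that
    -- hop.
    have hout : ∀ i, ∀ m ∈ outboxStep γ a (t + 1) (netState G γ a t) i,
        1 ≤ m.2 ∧ m.2 ≤ t + 1 ∧ a m.2 m.1 ∧ G.edist m.1 i ≤ ((t + 1 - m.2 : ℕ) : ℕ∞) := by
      intro i m hm
      rcases mem_outboxStep.1 hm with ⟨h, rfl⟩ | ⟨h, -, -⟩
      · simpa using h
      · obtain ⟨h1, h2, h3, h4⟩ := ih i m h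
        exact ⟨h1, by omega, h3, h4⟩
    intro i m hm
    rcases (mem_known_netStep G γ).1 hm with h | h | ⟨l, hl, h⟩
    · obtain ⟨h1, h2, h3, h4⟩ := ih i m h
      refine ⟨h1, by omega, h3, h4.trans ?_⟩
      exact_mod_cast (by omega : t + 1 - m.2 ≤ t + 1 + 1 - m.2)
    · obtain ⟨h1, h2, h3, h4⟩ := hout i m h
      refine ⟨h1, h2, h3, h4.trans ?_⟩
      exact_mod_cast (by omega : t + 1 - m.2 ≤ t + 1 + 1 - m.2)
    · obtain ⟨h1, h2, h3, h4⟩ := hout l m h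
      refine ⟨h1, h2, h3, ?_⟩
      calc G.edist m.1 i ≤ G.edist m.1 l + G.edist l i := SimpleGraph.edist_triangle
        _ ≤ ((t + 1 - m.2 : ℕ) : ℕ∞) + 1 := by
            gcongr
            exact (SimpleGraph.edist_eq_one_iff_adj.2 hl).le
        _ = ((t + 1 + 1 - m.2 : ℕ) : ℕ∞) := by
            rw [show t + 1 + 1 - m.2 = (t + 1 - m.2) + 1 by omega, Nat.cast_add, Nat.cast_one]

/-- A sent message was initiated, in an earlier round, by an agent at distance less than `γ`. -/
lemma netState_sent_spec (hγ : 1 ≤ γ) (a : ℕ → Fin N → Prop) (t : ℕ) :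
    ∀ i, ∀ m ∈ (netState G γ a t).sent i,
      1 ≤ m.2 ∧ m.2 ≤ t ∧ a m.2 m.1 ∧ G.edist m.1 i ≤ ((γ - 1 : ℕ) : ℕ∞) := by
  induction t with
  | zero => intro i m hm; simp [netState] at hm
  | succ t ih =>
    intro i m hm
    rcases (mem_sent_netStep G γ).1 hm with h | h
    · obtain ⟨h1, h2, h3, h4⟩ := ih i m h
      exact ⟨h1, by omega, h3, h4⟩
    · rcases mem_outboxStep.1 h with ⟨hi, rfl⟩ | ⟨hm', -, hage⟩
      · simpa using hi
      · obtain ⟨h1, h2, h3, h4⟩ := netState_known_spec G γ a t i m hm'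
        refine ⟨h1, by omega, h3, h4.trans ?_⟩
        exact_mod_cast (by omega : t + 1 - m.2 ≤ γ - 1)

/-- What happens to a message depends only on whether it is initiated. -/
lemma netState_mem_congr {a b : ℕ → Fin N → Prop} {m : MessageId N} (h : a m.2 m.1 ↔ b m.2 m.1)
    (t : ℕ) : ∀ i,
      (m ∈ (netState G γ a t).sent i ↔ m ∈ (netState G γ b t).sent i) ∧
      (m ∈ (netState G γ a t).known i ↔ m ∈ (netState G γ b t).known i) := by
  induction t with
  | zero => intro i; simp [netState]
  | succ t ih =>
    have hout : ∀ i, m ∈ outboxStep γ a (t + 1) (netState G γ a t) i ↔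
        m ∈ outboxStep γ b (t + 1) (netState G γ b t) i := by
      intro i
      rw [mem_outboxStep, mem_outboxStep, (ih i).1, (ih i).2]
      refine or_congr_left ?_
      constructor <;> rintro ⟨h1, rfl⟩
      · exact ⟨h.1 h1, rfl⟩
      · exact ⟨h.2 h1, rfl⟩
    intro i
    refine ⟨?_, ?_⟩
    · exact (mem_sent_netStep G γ).trans
        ((or_congr (ih i).1 (hout i)).trans (mem_sent_netStep G γ).symm)
    · refine (mem_known_netStep G γ).trans (Iff.trans ?_ (mem_known_netStep G γ).symm)
      simp only [(ih i).2, hout]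

/-- Separates the randomness from the network: routes are read off the deterministic run in which
everyone initiates, and only the initiation of the message itself is random. -/
lemma mem_sent_iff (hγ : 1 ≤ γ) (a : ℕ → Fin N → Prop) (t : ℕ) (i : Fin N) (m : MessageId N) :
    m ∈ (netState G γ a t).sent i ↔
      a m.2 m.1 ∧ m ∈ (netState G γ (fun _ _ => True) t).sent i := by
  by_cases h : a m.2 m.1
  · simpa [h] using ((netState_mem_congr G γ (b := fun _ _ => True) (by simpa using h) t) i).1
  · exact iff_of_false (fun hm => h (netState_sent_spec G γ hγ a t i m hm).2.2.1)
      (fun hm => h hm.1)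

lemma mem_known_iff (a : ℕ → Fin N → Prop) (t : ℕ) (i : Fin N) (m : MessageId N) :
    m ∈ (netState G γ a t).known i ↔
      a m.2 m.1 ∧ m ∈ (netState G γ (fun _ _ => True) t).known i := by
  by_cases h : a m.2 m.1
  · simpa [h] using ((netState_mem_congr G γ (b := fun _ _ => True) (by simpa using h) t) i).2
  · exact iff_of_false (fun hm => h (netState_known_spec G γ a t i m hm).2.2.1) (fun hm => h hm.1)

/-- Each outbox is disjoint from everything sent before: a new message carries the current round in
its identifier, and forwarded ones are filtered against `sent`. The cost thus telescopes. -/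
lemma sum_card_outbox (hγ : 1 ≤ γ) (a : ℕ → Fin N → Prop) (i : Fin N) (T : ℕ) :
    ∑ t ∈ Finset.Icc 1 T, ((netState G γ a t).outbox i).card =
      ((netState G γ a T).sent i).card := by
  classical
  induction T with
  | zero => simp [netState]
  | succ T ih =>
    rw [Finset.sum_Icc_succ_top (by omega), ih]
    have hs : (netState G γ a (T + 1)).sent i =
        (netState G γ a T).sent i ∪ (netState G γ a (T + 1)).outbox i := by
      ext m
      exact (mem_sent_netStep G γ).trans (by simp [netState, netStep])
    rw [hs, Finset.card_union_of_disjoint]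
    refine Finset.disjoint_left.2 fun m h1 h2 => ?_
    rcases mem_outboxStep.1 h2 with ⟨-, rfl⟩ | ⟨-, h, -⟩
    · have := (netState_sent_spec G γ hγ a T i _ h1).2.1
      simp at this
    · exact h h1

open Classical in
/-- The number of messages initiated by agent `i` in the rounds `1, …, T`. -/
noncomputable def initCount (a : ℕ → Fin N → Prop) (T : ℕ) (i : Fin N) : ℝ :=
  ∑ s ∈ Finset.range T, if a (s + 1) i then 1 else 0

open Classical in
-- Gives the cost as a finite sum of indicators, from which integrability follows. Rounds are
-- written `u + 1` because the choices of that round are determined by `info u`.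
lemma card_sent_eq (hγ : 1 ≤ γ) (a : ℕ → Fin N → Prop) (i : Fin N) (T : ℕ) :
    (((netState G γ a T).sent i).card : ℝ) = ∑ j : Fin N, ∑ u ∈ Finset.range T,
      if a (u + 1) j ∧ (j, u + 1) ∈ (netState G γ (fun _ _ => True) T).sent i
        then (1 : ℝ) else 0 := by
  have hshift : ∀ j : Fin N, (∑ u ∈ Finset.range T,
      if a (u + 1) j ∧ (j, u + 1) ∈ (netState G γ (fun _ _ => True) T).sent i
        then (1 : ℝ) else 0) = ∑ u ∈ Finset.Ico 1 (T + 1),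
      if a u j ∧ (j, u) ∈ (netState G γ (fun _ _ => True) T).sent i then (1 : ℝ) else 0 := by
    intro j
    rw [Finset.range_eq_Ico, Finset.sum_Ico_add' (fun u => if a u j ∧
      (j, u) ∈ (netState G γ (fun _ _ => True) T).sent i then (1 : ℝ) else 0) 0 T 1, zero_add]
  simp_rw [hshift]
  rw [← Finset.sum_product', ← Finset.sum_filter, Finset.sum_const, nsmul_eq_mul, mul_one]
  congr 2
  ext m
  have := netState_sent_spec G γ hγ a T i m
  rw [mem_sent_iff G γ hγ a T i m] at this ⊢
  simp only [Finset.mem_filter, Finset.mem_product, Finset.mem_univ, true_and, Finset.mem_Ico]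
  constructor
  · exact fun h => ⟨⟨(this h).1, Nat.lt_succ_of_le (this h).2.1⟩, h⟩
  · exact fun h => h.2

lemma ncard_edist_le (r : ℕ) (j : Fin N) :
    {i | G.edist j i ≤ (r : ℕ∞)}.ncard = powerDegree G r j + 1 := by
  have : {i | G.edist j i ≤ (r : ℕ∞)} = insert j ((powerGraph G r).neighborSet j) := by
    ext i
    by_cases h : i = j
    · subst h; simp
    · simp [powerGraph, h, Ne.symm h]
  rw [this, Set.ncard_insert_of_notMem (by simp), powerDegree]

/-- Each initiated message is sent at most once by each agent at distance less than `γ`. -/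
lemma sum_card_sent_le (hγ : 1 ≤ γ) (a : ℕ → Fin N → Prop) (T : ℕ) :
    ∑ i : Fin N, (((netState G γ a T).sent i).card : ℝ) ≤
      ∑ j : Fin N, ((powerDegree G (γ - 1) j : ℝ) + 1) * initCount a T j := by
  classical
  calc ∑ i : Fin N, (((netState G γ a T).sent i).card : ℝ)
      ≤ ∑ i : Fin N, ∑ j : Fin N, (if G.edist j i ≤ ((γ - 1 : ℕ) : ℕ∞) then (1 : ℝ) else 0) *
          initCount a T j := by
        refine Finset.sum_le_sum fun i _ => ?_
        rw [card_sent_eq G γ hγ]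
        refine Finset.sum_le_sum fun j _ => ?_
        rw [initCount, Finset.mul_sum]
        refine Finset.sum_le_sum fun u _ => ?_
        by_cases h : (j, u + 1) ∈ (netState G γ (fun _ _ => True) T).sent i
        · have := (netState_sent_spec G γ hγ _ T i _ h).2.2.2
          simp only at this
          simp only [h, this, and_true, if_true, one_mul, le_refl]
        · simp only [h, and_false, if_false]
          positivity
    _ = _ := by
        -- Counting per initiator instead of per sender turns the distance condition into the size
        -- of a ball.
        rw [Finset.sum_comm]
        refine Finset.sum_congr rfl fun j _ => ?_
        rw [← Finset.sum_mul, Finset.sum_boole]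
        congr 1
        rw [← Nat.cast_add_one, ← ncard_edist_le, ← Set.ncard_coe_finset]
        simp

open Classical in
/-- Observations as a sum over all rounds and agents. -/
lemma observedSum_eq {K : ℕ} (A B : ℕ → Fin N → Fin K) (w : ℕ → Fin N → ℝ) (t : ℕ) (i : Fin N)
    (k : Fin K) :
    observedSum G γ A B w t i k = ∑ u ∈ Finset.range t, ∑ j : Fin N,
      if A (u + 1) j = k ∧ (j = i ∨ (initiates A B (u + 1) j ∧
        (j, u + 1) ∈ (netState G γ (fun _ _ => True) t).known i)) then w (u + 1) j else 0 := by
  have hk : ∑ m ∈ (netState G γ (initiates A B) t).known i,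
      (if m.1 ≠ i ∧ A m.2 m.1 = k then w m.2 m.1 else 0) =
      ∑ u ∈ Finset.range t, ∑ j : Fin N, if j ≠ i ∧ A (u + 1) j = k ∧
        initiates A B (u + 1) j ∧ (j, u + 1) ∈ (netState G γ (fun _ _ => True) t).known i
        then w (u + 1) j else 0 := by
    have himg : (netState G γ (initiates A B) t).known i ⊆
        (Finset.univ : Finset (Fin N)) ×ˢ Finset.Icc 1 t := by
      intro m hm
      have := netState_known_spec G γ _ t i m hm
      simp only [Finset.mem_product, Finset.mem_univ, true_and, Finset.mem_Icc]
      exact ⟨this.1, this.2.1⟩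
    have e : (netState G γ (initiates A B) t).known i =
        ((Finset.univ : Finset (Fin N)) ×ˢ Finset.Icc 1 t).filter
          (fun m => m ∈ (netState G γ (initiates A B) t).known i) := by
      rw [Finset.filter_mem_eq_inter, Finset.inter_eq_right.2 himg]
    rw [e, Finset.sum_filter, Finset.sum_product_right, Finset.range_eq_Ico,
      Finset.sum_Ico_add' (fun u => ∑ j : Fin N, if j ≠ i ∧ A u j = k ∧
        initiates A B u j ∧ (j, u) ∈ (netState G γ (fun _ _ => True) t).known i
        then w u j else 0) 0 t 1]
    refine Finset.sum_congr (by ext; simp) fun u _ => Finset.sum_congr rfl fun j _ => ?_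
    rw [← ite_and]
    refine if_congr ?_ rfl rfl
    rw [mem_known_iff]
    tauto
  have hown : ∑ s ∈ Finset.Icc 1 t, (if A s i = k then w s i else 0) =
      ∑ u ∈ Finset.range t, ∑ j : Fin N, if j = i ∧ A (u + 1) j = k then w (u + 1) j else 0 := by
    rw [Finset.range_eq_Ico, Finset.sum_Ico_add' (fun u => ∑ j : Fin N,
      if j = i ∧ A u j = k then w u j else 0) 0 t 1]
    refine Finset.sum_congr (by ext; simp) fun u _ => ?_
    simp [ite_and]
  rw [observedSum, hk, hown, ← Finset.sum_add_distrib]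
  refine Finset.sum_congr rfl fun u _ => ?_
  rw [← Finset.sum_add_distrib]
  refine Finset.sum_congr rfl fun j _ => ?_
  by_cases h : j = i <;> by_cases h' : A (u + 1) j = k <;> simp [h, h']

end Network

/-! ### Behaviour along one trajectory -/

/-- The gap of a suboptimal arm; for the best arm, the smallest gap. -/
noncomputable def armGap {K : ℕ} (μ : Fin K → ℝ) (best k : Fin K) : ℝ :=
  if k = best then minGap μ best else μ best - μ k

lemma minGap_le {K : ℕ} (μ : Fin K → ℝ) {best k : Fin K} (h : k ≠ best) :
    minGap μ best ≤ μ best - μ k :=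
  ciInf_le (f := fun k : {k : Fin K // k ≠ best} => μ best - μ k) (Set.finite_range _).bddBelow
    ⟨k, h⟩

lemma minGap_pos {K : ℕ} (hK : 2 ≤ K) (μ : Fin K → ℝ) {best : Fin K}
    (hbest : ∀ k, k ≠ best → μ k < μ best) : 0 < minGap μ best := by
  have : Nontrivial (Fin K) := Fin.nontrivial_iff_two_le.2 hK
  obtain ⟨k, hk⟩ := exists_ne best
  have : Nonempty {k : Fin K // k ≠ best} := ⟨⟨k, hk⟩⟩
  obtain ⟨⟨l, hl⟩, h⟩ := exists_eq_ciInf_of_finite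
    (f := fun k : {k : Fin K // k ≠ best} => μ best - μ k)
  rw [minGap, ← h]
  exact sub_pos.2 (hbest l hl)

lemma armGap_pos {K : ℕ} (hK : 2 ≤ K) (μ : Fin K → ℝ) {best : Fin K}
    (hbest : ∀ k, k ≠ best → μ k < μ best) (k : Fin K) : 0 < armGap μ best k := by
  unfold armGap
  split_ifs with h
  · exact minGap_pos hK μ hbest
  · exact sub_pos.2 (hbest k h)

/-- `Nat.count p` is injective on the points satisfying `p` and starts from 0, so it takes at most
⌊x⌋ + 1 values here. -/
lemma card_filter_count_le (p : ℕ → Prop) [DecidablePred p] {x : ℝ} (hx : 0 ≤ x) (T : ℕ) :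
    (((Finset.range T).filter (fun s => p s ∧ (Nat.count p s : ℝ) ≤ x)).card : ℝ) ≤ x + 1 := by
  have : ((Finset.range T).filter (fun s => p s ∧ (Nat.count p s : ℝ) ≤ x)).card ≤
      (Finset.range (⌊x⌋₊ + 1)).card := by
    refine Finset.card_le_card_of_injOn (Nat.count p) ?_ ?_
    · intro s hs
      simp only [Finset.coe_filter, Set.mem_ofPred_eq] at hs
      simpa [Nat.lt_succ_iff] using Nat.le_floor hs.2.2
    · intro s hs t ht h
      simp only [Finset.coe_filter, Set.mem_ofPred_eq] at hs ht
      exact Nat.count_injective hs.2.1 ht.2.1 h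
  rw [Finset.card_range] at this
  calc _ ≤ ((⌊x⌋₊ + 1 : ℕ) : ℝ) := by exact_mod_cast this
    _ ≤ x + 1 := by push_cast; gcongr; exact Nat.floor_le hx

section Trajectory

variable {N K : ℕ} (G : SimpleGraph (Fin N)) (γ : ℕ) (A B : ℕ → Fin N → Fin K)
  (X : ℕ → Fin N → ℝ)

lemma obsCount_nonneg (t : ℕ) (i : Fin N) (k : Fin K) : 0 ≤ obsCount G γ A B t i k := by
  unfold obsCount observedSum
  positivity

lemma obsCount_zero (i : Fin N) (k : Fin K) : obsCount G γ A B 0 i k = 0 := by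
  simp [obsCount, observedSum, netState]

lemma count_le_obsCount (t : ℕ) (i : Fin N) (k : Fin K) :
    (Nat.count (fun u => A (u + 1) i = k) t : ℝ) ≤ obsCount G γ A B t i k := by
  classical
  rw [obsCount, observedSum_eq, Nat.count_eq_card_filter_range, ← Finset.sum_boole]
  refine Finset.sum_le_sum fun u _ => ?_
  refine le_trans (le_of_eq ?_) (Finset.single_le_sum (f := fun j => if A (u + 1) j = k ∧
    (j = i ∨ (initiates A B (u + 1) j ∧ (j, u + 1) ∈
      (netState G γ (fun _ _ => True) t).known i)) then (1 : ℝ) else 0)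
    (fun j _ => by positivity) (Finset.mem_univ i))
  simp

lemma observedSum_sub_const (c : ℝ) (t : ℕ) (i : Fin N) (k : Fin K) :
    observedSum G γ A B (fun u j => X u j - c) t i k =
      observedSum G γ A B X t i k - c * obsCount G γ A B t i k := by
  classical
  simp only [obsCount, observedSum_eq, Finset.mul_sum, ← Finset.sum_sub_distrib]
  refine Finset.sum_congr rfl fun u _ => Finset.sum_congr rfl fun j _ => ?_
  split_ifs <;> simp

/-- The sum of the observed rewards of an arm, centred at `m`, exceeds the confidence radius in
the direction `ε = ±1`. -/
def ConfidenceFails (σ ξ m ε : ℝ) (t : ℕ) (i : Fin N) (k : Fin K) : Prop :=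
  obsCount G γ A B t i k ≠ 0 ∧
    σ * √(2 * (ξ + 1) * Real.log t * obsCount G γ A B t i k) ≤
      ε * observedSum G γ A B (fun u j => X u j - m) t i k

/-- The direction in which the estimate of an arm must not err. -/
def errSign (best k : Fin K) : ℝ := if k = best then -1 else 1

variable {G γ A B X}

/-- `ConfidenceFails` speaks of sums, which suit the exponential martingale; dividing by the count
gives back the radius in the index. -/
lemma lt_radius_of_not_confidenceFails {σ ξ m ε : ℝ} {t : ℕ} {i : Fin N} {k : Fin K}
    (h : ¬ ConfidenceFails G γ A B X σ ξ m ε t i k) (h0 : obsCount G γ A B t i k ≠ 0) :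
    ε * (estMean G γ A B X t i k - m) <
      σ * √(2 * (ξ + 1) * Real.log t / obsCount G γ A B t i k) := by
  have hpos : 0 < obsCount G γ A B t i k := (obsCount_nonneg G γ A B t i k).lt_of_ne' h0
  rw [ConfidenceFails, not_and, not_le, observedSum_sub_const] at h
  have h := h h0
  rw [estMean, if_neg h0]
  set n := obsCount G γ A B t i k
  set L := 2 * (ξ + 1) * Real.log t
  have hs : √(L * n) = √(L / n) * n := by
    rw [show L * n = (L / n) * (n * n) by field_simp, Real.sqrt_mul' _ (by positivity),
      Real.sqrt_mul_self hpos.le]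
  rw [hs] at h
  have : ε * (observedSum G γ A B X t i k / n - m) * n <
      σ * √(L / n) * n := by
    calc _ = ε * (observedSum G γ A B X t i k - m * n) := by field_simp
      _ < _ := by linarith
  exact lt_of_mul_lt_mul_right this hpos.le

/-- Source of the constant 8(ξ+1): with `L = 2(ξ+1) log s`, that many observations push the radius
below half the gap. -/
lemma radius_le {σ L n d : ℝ} (hσ : 0 < σ) (hn : 0 < n) (hd : 0 < d)
    (h : 4 * σ ^ 2 / d ^ 2 * L ≤ n) : σ * √(L / n) ≤ d / 2 := by
  have h' : 4 * σ ^ 2 * L ≤ n * d ^ 2 := by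
    rw [div_mul_eq_mul_div, div_le_iff₀ (by positivity)] at h; exact h
  have : √(L / n) ≤ d / (2 * σ) := by
    refine Real.sqrt_le_iff.2 ⟨by positivity, ?_⟩
    rw [div_pow, div_le_div_iff₀ hn (by positivity)]
    nlinarith
  calc σ * √(L / n) ≤ σ * (d / (2 * σ)) := by gcongr
    _ = d / 2 := by field_simp

/-- If all confidence bounds hold, an arm that is pulled but not greedy has few observations. -/
lemma obsCount_le_of_initiates {σ ξ : ℝ} (hσ : 0 < σ) (hξ : 0 ≤ ξ) {μ : Fin K → ℝ} {best : Fin K}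
    (hK : 2 ≤ K) (hbest : ∀ k, k ≠ best → μ k < μ best) {s : ℕ} {i : Fin N}
    (harm : ∀ k, ucbIndex G γ σ ξ A B X s i k ≤ ucbIndex G γ σ ξ A B X s i (A (s + 1) i))
    (hgreedy : ∀ k, estMean G γ A B X s i k ≤ estMean G γ A B X s i (B (s + 1) i))
    (hinit : initiates A B (s + 1) i)
    (hconf : ∀ k, ¬ ConfidenceFails G γ A B X σ ξ (μ k) (errSign best k) s i k) :
    obsCount G γ A B s i (A (s + 1) i) ≤
      8 * (ξ + 1) * σ ^ 2 / armGap μ best (A (s + 1) i) ^ 2 * Real.log s := by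
  have hlog : 0 ≤ Real.log s := Real.log_natCast_nonneg s
  unfold initiates at hinit
  set a := A (s + 1) i
  set b := B (s + 1) i
  by_contra! hlt
  have ha : 0 < obsCount G γ A B s i a := lt_of_le_of_lt (by positivity) hlt
  -- The pulled arm has a finite index and it is maximal, so no index is infinite.
  have hne : ∀ k, obsCount G γ A B s i k ≠ 0 := by
    intro k hk
    have := harm k
    rw [ucbIndex, if_pos hk, ucbIndex, if_neg ha.ne', top_le_iff] at this
    exact EReal.coe_ne_top _ this
  have hidx : ∀ k, estMean G γ A B X s i k +
      σ * √(2 * (ξ + 1) * Real.log s / obsCount G γ A B s i k) ≤ estMean G γ A B X s i a +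
      σ * √(2 * (ξ + 1) * Real.log s / obsCount G γ A B s i a) := by
    intro k
    have := harm k
    rw [ucbIndex, if_neg (hne k), ucbIndex, if_neg (hne a)] at this
    exact_mod_cast this
  have hrad := radius_le (L := 2 * (ξ + 1) * Real.log s) hσ ha (armGap_pos hK μ hbest a)
    (le_trans (le_of_eq (by ring)) hlt.le)
  have hb := lt_radius_of_not_confidenceFails (hconf best) (hne best)
  have hsub : ∀ k, k ≠ best → estMean G γ A B X s i k - μ k <
      σ * √(2 * (ξ + 1) * Real.log s / obsCount G γ A B s i k) := by
    intro k hk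
    simpa [errSign, hk] using lt_radius_of_not_confidenceFails (hconf k) (hne k)
  rw [errSign, if_pos rfl] at hb
  -- If `a` is best, then `b` has the larger mean estimate but not the larger index, so its radius
  -- is at most that of `a`. The two confidence bounds then put the gap of `b` strictly below twice
  -- the radius of `a`. If `a` is suboptimal, this is the usual UCB comparison with the best arm.
  by_cases hab : a = best
  · have hbb : b ≠ best := fun h => hinit (hab.trans h.symm)
    have h1 := hsub b hbb
    have h2 := hidx b
    have h3 := hgreedy a
    have h4 := minGap_le μ hbb
    rw [armGap, if_pos hab] at hrad
    rw [← hab] at hb h4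
    rw [← hab] at hrad
    linarith
  · have h1 := hsub a hab
    have h2 := hidx best
    rw [armGap, if_neg hab] at hrad
    linarith

open Classical in
/-- The number of initiated messages along one trajectory. -/
lemma initCount_le {σ ξ : ℝ} (hσ : 0 < σ) (hξ : 0 ≤ ξ) {μ : Fin K → ℝ} {best : Fin K}
    (hK : 2 ≤ K) (hbest : ∀ k, k ≠ best → μ k < μ best) {i : Fin N}
    (harm : ∀ s, 1 ≤ s → ∀ k,
      ucbIndex G γ σ ξ A B X s i k ≤ ucbIndex G γ σ ξ A B X s i (A (s + 1) i))
    (hgreedy : ∀ s k, estMean G γ A B X s i k ≤ estMean G γ A B X s i (B (s + 1) i)) (T : ℕ) :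
    initCount (initiates A B) T i ≤
      ∑ k, (8 * (ξ + 1) * σ ^ 2 / armGap μ best k ^ 2 * Real.log T + 1) +
      ∑ s ∈ Finset.Ico 1 T, ∑ k,
        if ConfidenceFails G γ A B X σ ξ (μ k) (errSign best k) s i k then 1 else 0 := by
  set x : Fin K → ℝ := fun k => 8 * (ξ + 1) * σ ^ 2 / armGap μ best k ^ 2 * Real.log T
  have hx : ∀ k, 0 ≤ x k := fun k => by
    have := Real.log_natCast_nonneg T
    positivity
  set F : ℕ → ℝ := fun s => ∑ k,
    if ConfidenceFails G γ A B X σ ξ (μ k) (errSign best k) s i k then 1 else 0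
  have hF : ∀ s, 0 ≤ F s := fun s => by positivity
  -- Each initiation is charged either to the pulled arm, whose earlier own pulls are then few, or
  -- to a failed confidence bound.
  have hstep : ∀ s ∈ Finset.range T, (if initiates A B (s + 1) i then (1 : ℝ) else 0) ≤
      (∑ k, if A (s + 1) i = k ∧ (Nat.count (fun u => A (u + 1) i = k) s : ℝ) ≤ x k
        then (1 : ℝ) else 0) + if 1 ≤ s then F s else 0 := by
    intro s hs
    have hsT := Finset.mem_range.1 hs
    have hsum : 0 ≤ ∑ k, if A (s + 1) i = k ∧
        (Nat.count (fun u => A (u + 1) i = k) s : ℝ) ≤ x k then (1 : ℝ) else 0 := by positivity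
    have hF' : 0 ≤ if 1 ≤ s then F s else 0 := by split_ifs <;> simp [hF]
    by_cases hinit : initiates A B (s + 1) i
    swap
    · rw [if_neg hinit]; exact add_nonneg hsum hF'
    rw [if_pos hinit]
    by_cases hgood : ∀ k, ¬ ConfidenceFails G γ A B X σ ξ (μ k) (errSign best k) s i k
    · have hle : obsCount G γ A B s i (A (s + 1) i) ≤ x (A (s + 1) i) := by
        rcases Nat.eq_zero_or_pos s with rfl | hpos
        · rw [obsCount_zero]; exact hx _
        · refine (obsCount_le_of_initiates hσ hξ hK hbest (harm s hpos) (hgreedy s) hinit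
            hgood).trans ?_
          have : Real.log s ≤ Real.log T :=
            Real.log_le_log (by exact_mod_cast hpos) (by exact_mod_cast hsT.le)
          simp only [x]
          gcongr
      have h1 : (1 : ℝ) ≤ ∑ k, if A (s + 1) i = k ∧
          (Nat.count (fun u => A (u + 1) i = k) s : ℝ) ≤ x k then (1 : ℝ) else 0 := by
        refine le_trans (le_of_eq ?_) (Finset.single_le_sum (f := fun k => if A (s + 1) i = k ∧
          (Nat.count (fun u => A (u + 1) i = k) s : ℝ) ≤ x k then (1 : ℝ) else 0)
          (fun k _ => by positivity) (Finset.mem_univ (A (s + 1) i)))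
        rw [if_pos ⟨rfl, (count_le_obsCount G γ A B s i _).trans hle⟩]
      linarith
    · push Not at hgood
      obtain ⟨k, hk⟩ := hgood
      -- Before round 1 there are no observations, hence no failures, so they are summed from `s =
      -- 1` on.
      have hpos : 1 ≤ s := by
        by_contra h
        obtain rfl : s = 0 := by omega
        exact hk.1 (obsCount_zero G γ A B i k)
      have h1 : 1 ≤ F s := by
        refine le_trans (le_of_eq ?_) (Finset.single_le_sum (f := fun k =>
          if ConfidenceFails G γ A B X σ ξ (μ k) (errSign best k) s i k then (1 : ℝ) else 0)
          (fun k _ => by positivity) (Finset.mem_univ k))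
        rw [if_pos hk]
      rw [if_pos hpos]
      linarith
  calc initCount (initiates A B) T i
      ≤ ∑ s ∈ Finset.range T, ((∑ k, if A (s + 1) i = k ∧
        (Nat.count (fun u => A (u + 1) i = k) s : ℝ) ≤ x k then (1 : ℝ) else 0) +
          if 1 ≤ s then F s else 0) := Finset.sum_le_sum hstep
    _ = (∑ k, ∑ s ∈ Finset.range T, if A (s + 1) i = k ∧
        (Nat.count (fun u => A (u + 1) i = k) s : ℝ) ≤ x k then (1 : ℝ) else 0) +
          ∑ s ∈ Finset.Ico 1 T, F s := by
        rw [Finset.sum_add_distrib, Finset.sum_comm, ← Finset.sum_filter]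
        congr 2
        ext s
        simp [and_comm]
    _ ≤ _ := by
        gcongr with k
        rw [Finset.sum_boole]
        exact card_filter_count_le (fun u => A (u + 1) i = k) (hx k) T

end Trajectory

/-! ### Concentration -/

section Concentration

variable {N K : ℕ} {G : SimpleGraph (Fin N)} {γ : ℕ} {σ ξ : ℝ} {ν : Fin K → Measure ℝ}
  {Ω : Type*} [mΩ : MeasurableSpace Ω] {P : Measure Ω}

namespace ComExMPUCB

lemma measurable_draw (run : ComExMPUCB G γ σ ξ ν P) (t : ℕ) (i : Fin N) (k : Fin K) :
    Measurable (run.draw (t + 1) i k) :=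
  (run.draw_measurable t i k).mono (run.info.le _) le_rfl

lemma hasSubgaussianMGF_draw (run : ComExMPUCB G γ σ ξ ν P) {k : Fin K} {m : ℝ} {c : ℝ≥0}
    (h : HasSubgaussianMGF (fun x => x - m) c (ν k)) (t : ℕ) (i : Fin N) :
    HasSubgaussianMGF (fun ω => run.draw (t + 1) i k ω - m) c P := by
  rw [← run.draw_law t i k] at h
  exact h.of_map (run.measurable_draw t i k).aemeasurable

/-- The exponential moment of the rewards of one round, compensated by the variance proxy. -/
lemma lintegral_exp_round_le (run : ComExMPUCB G γ σ ξ ν P) {k : Fin K} {m : ℝ} {c : ℝ≥0}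
    (h : HasSubgaussianMGF (fun x => x - m) c (ν k)) (hc : (c : ℝ) ≤ σ ^ 2) (l : ℝ) (t : ℕ)
    (J : Finset (Fin N)) :
    ∫⁻ ω, ENNReal.ofReal (Real.exp (∑ j ∈ J,
      (l * (run.draw (t + 1) j k ω - m) - l ^ 2 * σ ^ 2 / 2))) ∂P ≤ 1 := by
  have hind : iIndepFun (fun j : Fin N => fun ω => run.draw (t + 1) j k ω - m) P :=
    ((run.draw_indep t).precomp (g := fun j : Fin N => (j, k))
      (fun _ _ h => (Prod.ext_iff.1 h).1)).comp (fun _ x => x - m)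
      (fun _ => measurable_id.sub_const m)
  have hsum := HasSubgaussianMGF.sum_of_iIndepFun hind (s := J)
    (fun j _ => run.hasSubgaussianMGF_draw h t j)
  have heq : ∀ ω, Real.exp (∑ j ∈ J, (l * (run.draw (t + 1) j k ω - m) - l ^ 2 * σ ^ 2 / 2)) =
      Real.exp (l * ∑ j ∈ J, (run.draw (t + 1) j k ω - m)) *
        Real.exp (-(J.card * (l ^ 2 * σ ^ 2 / 2))) := by
    intro ω
    rw [← Real.exp_add, Finset.sum_sub_distrib, Finset.mul_sum, Finset.sum_const, nsmul_eq_mul]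
    rfl
  simp_rw [heq]
  rw [← ofReal_integral_eq_lintegral_ofReal ((hsum.integrable_exp_mul l).mul_const _)
    (ae_of_all _ fun ω => by positivity), integral_mul_const, ← ENNReal.ofReal_one]
  refine ENNReal.ofReal_le_ofReal ?_
  calc _ ≤ Real.exp ((∑ j ∈ J, c : ℝ≥0) * l ^ 2 / 2) *
        Real.exp (-(J.card * (l ^ 2 * σ ^ 2 / 2))) := by
        gcongr
        exact hsum.mgf_le l
    _ ≤ 1 := by
        rw [← Real.exp_add, Real.exp_le_one_iff, Finset.sum_const, nsmul_eq_mul]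
        push_cast
        have : (J.card : ℝ) * l ^ 2 * c ≤ J.card * l ^ 2 * σ ^ 2 := by gcongr
        linarith

lemma measurable_draw_round (run : ComExMPUCB G γ σ ξ ν P) (t : ℕ) (j : Fin N) (k : Fin K) :
    Measurable[⨆ p : Fin N × Fin K, MeasurableSpace.comap (run.draw (t + 1) p.1 p.2) inferInstance]
      (run.draw (t + 1) j k) :=
  (comap_measurable (run.draw (t + 1) j k)).mono
    (le_iSup (fun p : Fin N × Fin K =>
      MeasurableSpace.comap (run.draw (t + 1) p.1 p.2) inferInstance) (j, k)) le_rfl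

/-- The exponential supermartingale of the rewards of an arm, observed at predictable places. -/
lemma lintegral_exp_observed_le [IsProbabilityMeasure P] (run : ComExMPUCB G γ σ ξ ν P)
    {k : Fin K} {m : ℝ} {c : ℝ≥0}
    (h : HasSubgaussianMGF (fun x => x - m) c (ν k)) (hc : (c : ℝ) ≤ σ ^ 2) (l : ℝ)
    (W : ℕ → Fin N → Set Ω) (hW : ∀ u j, MeasurableSet[run.info u] (W u j)) (n : ℕ) :
    ∫⁻ ω, ENNReal.ofReal (Real.exp (∑ u ∈ Finset.range n, ∑ j, (W u j).indicator
      (fun ω => l * (run.draw (u + 1) j k ω - m) - l ^ 2 * σ ^ 2 / 2) ω)) ∂P ≤ 1 := by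
  classical
  induction n with
  | zero => simp
  | succ n ih =>
    set M : Ω → ENNReal := fun ω => ENNReal.ofReal (Real.exp (∑ u ∈ Finset.range n, ∑ j,
      (W u j).indicator (fun ω => l * (run.draw (u + 1) j k ω - m) - l ^ 2 * σ ^ 2 / 2) ω))
    set D : Finset (Fin N) → Ω → ENNReal := fun J ω => ENNReal.ofReal (Real.exp (∑ j ∈ J,
      (l * (run.draw (n + 1) j k ω - m) - l ^ 2 * σ ^ 2 / 2)))
    -- `E J`: exactly the agents in `J` are observed in the new round. `E J` and `M` belong to the
    -- past while `D J` involves only new draws, so each integral factorises and no conditional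
    -- expectation is needed.
    set E : Finset (Fin N) → Set Ω := fun J => ⋂ j, if j ∈ J then W n j else (W n j)ᶜ
    have hE : ∀ J ω, ω ∈ E J ↔ J = Finset.univ.filter (fun j => ω ∈ W n j) := by
      intro J ω
      simp only [E, Set.mem_iInter, Finset.ext_iff, Finset.mem_filter, Finset.mem_univ, true_and]
      refine forall_congr' fun j => ?_
      by_cases hj : j ∈ J <;> simp [hj]
    have hEm : ∀ J, MeasurableSet[run.info n] (E J) := by
      intro J
      refine MeasurableSet.iInter fun j => ?_
      split_ifs
      · exact hW n j
      · exact (hW n j).compl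
    have hMm : Measurable[run.info n] M := by
      refine Measurable.ennreal_ofReal (Real.measurable_exp.comp ?_)
      refine Finset.measurable_sum _ fun u hu => Finset.measurable_sum _ fun j _ => ?_
      have hu' : u + 1 ≤ n := Finset.mem_range.1 hu
      refine Measurable.indicator ?_ (run.info.mono (by omega : u ≤ n) _ (hW u j))
      exact ((((run.draw_measurable u j k).mono (run.info.mono hu') le_rfl).sub_const
        m).const_mul l).sub_const _
    have hDm : ∀ J, Measurable[⨆ p : Fin N × Fin K,
        MeasurableSpace.comap (run.draw (n + 1) p.1 p.2) inferInstance] (D J) := by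
      intro J
      refine Measurable.ennreal_ofReal (Real.measurable_exp.comp ?_)
      refine Finset.measurable_sum _ fun j _ => ?_
      exact (((run.measurable_draw_round n j k).sub_const m).const_mul l).sub_const _
    have hle : (⨆ p : Fin N × Fin K,
        MeasurableSpace.comap (run.draw (n + 1) p.1 p.2) inferInstance) ≤ mΩ :=
      iSup_le fun p => (run.measurable_draw n p.1 p.2).comap_le
    have hsplit : ∀ ω, ENNReal.ofReal (Real.exp (∑ u ∈ Finset.range (n + 1), ∑ j,
        (W u j).indicator (fun ω => l * (run.draw (u + 1) j k ω - m) - l ^ 2 * σ ^ 2 / 2) ω)) =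
        ∑ J, (E J).indicator M ω * D J ω := by
      intro ω
      rw [Finset.sum_eq_single (Finset.univ.filter (fun j => ω ∈ W n j))]
      · rw [Set.indicator_of_mem ((hE _ _).2 rfl), Finset.sum_range_succ, Real.exp_add,
          ENNReal.ofReal_mul (by positivity)]
        simp only [M, D, Finset.sum_filter, Set.indicator_apply]
      · intro J _ hJ
        rw [Set.indicator_of_notMem (fun h => hJ ((hE _ _).1 h)), zero_mul]
      · simp
    have hone : ∀ ω, ∑ J, (E J).indicator M ω = M ω := by
      intro ω
      rw [Finset.sum_eq_single (Finset.univ.filter (fun j => ω ∈ W n j))]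
      · rw [Set.indicator_of_mem ((hE _ _).2 rfl)]
      · intro J _ hJ
        rw [Set.indicator_of_notMem (fun h => hJ ((hE _ _).1 h))]
      · simp
    have hIm : ∀ J, Measurable[run.info n] ((E J).indicator M) :=
      fun J => hMm.indicator (hEm J)
    have hIm' : ∀ J, Measurable ((E J).indicator M) :=
      fun J => (hIm J).mono (run.info.le n) le_rfl
    simp_rw [hsplit]
    rw [lintegral_finsetSum (f := fun J ω => (E J).indicator M ω * D J ω) _
      fun J _ => (hIm' J).mul ((hDm J).mono hle le_rfl)]
    calc ∑ J, ∫⁻ ω, (E J).indicator M ω * D J ω ∂P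
        = ∑ J, (∫⁻ ω, (E J).indicator M ω ∂P) * ∫⁻ ω, D J ω ∂P :=
          Finset.sum_congr rfl fun J _ =>
            lintegral_mul_eq_lintegral_mul_lintegral_of_independent_measurableSpace
              (run.info.le n) hle (run.draw_indep_past n).symm (hIm J) (hDm J)
      _ ≤ ∑ J, ∫⁻ ω, (E J).indicator M ω ∂P := by
          refine Finset.sum_le_sum fun J _ => ?_
          exact (mul_le_mul_right (run.lintegral_exp_round_le h hc l n J) _).trans_eq (mul_one _)
      _ = ∫⁻ ω, M ω ∂P := by
          rw [← lintegral_finsetSum _ fun J _ => hIm' J]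
          simp_rw [hone]
      _ ≤ 1 := ih

/-! ### Predictability of the observed pulls and tail bounds. -/

variable (run : ComExMPUCB G γ σ ξ ν P)

/-- The event that agent `i`, at the end of round `t`, has observed the pull of arm `k` by agent
`j` in round `u + 1`. -/
def observedEvent (t : ℕ) (i : Fin N) (k : Fin K) (u : ℕ) (j : Fin N) : Set Ω :=
  {ω | run.arm (u + 1) j ω = k ∧ (j = i ∨ (run.arm (u + 1) j ω ≠ run.greedy (u + 1) j ω ∧
    (j, u + 1) ∈ (netState G γ (fun _ _ => True) t).known i))}

lemma measurableSet_initiates (u : ℕ) (j : Fin N) :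
    MeasurableSet[run.info u] {ω | run.arm (u + 1) j ω ≠ run.greedy (u + 1) j ω} := by
  have h : {ω | run.arm (u + 1) j ω ≠ run.greedy (u + 1) j ω} =
      ⋃ k, run.arm (u + 1) j ⁻¹' {k} ∩ (run.greedy (u + 1) j ⁻¹' {k})ᶜ := by
    ext ω
    simp [eq_comm]
  rw [h]
  exact MeasurableSet.iUnion fun k => (run.arm_measurable u j (measurableSet_singleton k)).inter
    (run.greedy_measurable u j (measurableSet_singleton k)).compl

/-- The arms of round `u + 1` are chosen from `info u`, and the routing condition does not depend on
`ω`. -/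
lemma measurableSet_observedEvent (t : ℕ) (i : Fin N) (k : Fin K) (u : ℕ) (j : Fin N) :
    MeasurableSet[run.info u] (run.observedEvent t i k u j) := by
  refine MeasurableSet.inter (run.arm_measurable u j (measurableSet_singleton k)) ?_
  refine MeasurableSet.union (MeasurableSet.const _) ?_
  exact (run.measurableSet_initiates u j).inter (MeasurableSet.const _)

/-- The arms pulled along a trajectory. -/
abbrev arms (ω : Ω) : ℕ → Fin N → Fin K := fun s j => run.arm s j ω

/-- The greedy arms along a trajectory. -/
abbrev greedies (ω : Ω) : ℕ → Fin N → Fin K := fun s j => run.greedy s j ω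

/-- The rewards along a trajectory. -/
abbrev rewards (ω : Ω) : ℕ → Fin N → ℝ := fun s j => run.draw s j (run.arm s j ω) ω

/-- On the event the pulled arm is `k`, so the reward can be replaced by the draw of the fixed arm
`k`, which is independent of the past. -/
lemma observedSum_rewards_eq (f : ℝ → ℝ) (t : ℕ) (i : Fin N) (k : Fin K) (ω : Ω) :
    observedSum G γ (run.arms ω) (run.greedies ω) (fun u j => f (run.rewards ω u j)) t i k =
      ∑ u ∈ Finset.range t, ∑ j, (run.observedEvent t i k u j).indicator
        (fun ω => f (run.draw (u + 1) j k ω)) ω := by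
  classical
  rw [observedSum_eq]
  refine Finset.sum_congr rfl fun u _ => Finset.sum_congr rfl fun j _ => ?_
  rw [Set.indicator_apply]
  by_cases h : run.arm (u + 1) j ω = k
  · simp [observedEvent, initiates, arms, greedies, rewards, h]
  · simp [observedEvent, h]

lemma obsCount_eq (t : ℕ) (i : Fin N) (k : Fin K) (ω : Ω) :
    obsCount G γ (run.arms ω) (run.greedies ω) t i k =
      ∑ u ∈ Finset.range t, ∑ j, (run.observedEvent t i k u j).indicator (fun _ => 1) ω :=
  run.observedSum_rewards_eq (fun _ => 1) t i k ω

lemma exists_obsCount_eq (t : ℕ) (i : Fin N) (k : Fin K) (ω : Ω) :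
    ∃ n : ℕ, n ≤ t * N ∧ obsCount G γ (run.arms ω) (run.greedies ω) t i k = n := by
  classical
  refine ⟨∑ u ∈ Finset.range t, ∑ j, if ω ∈ run.observedEvent t i k u j then 1 else 0, ?_, ?_⟩
  · calc _ ≤ ∑ u ∈ Finset.range t, ∑ j : Fin N, 1 := by
          refine Finset.sum_le_sum fun u _ => Finset.sum_le_sum fun j _ => ?_
          split_ifs <;> simp
      _ = t * N := by simp
  · rw [obsCount_eq]
    push_cast
    simp only [Set.indicator_apply]

lemma measurable_observedSum {f : ℝ → ℝ} (hf : Measurable f) (t : ℕ) (i : Fin N) (k : Fin K) :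
    Measurable fun ω => observedSum G γ (run.arms ω) (run.greedies ω)
      (fun u j => f (run.rewards ω u j)) t i k := by
  simp_rw [observedSum_rewards_eq]
  refine Finset.measurable_sum _ fun u _ => Finset.measurable_sum _ fun j _ => ?_
  exact (hf.comp (run.measurable_draw u j k)).indicator
    (run.info.le u _ (run.measurableSet_observedEvent t i k u j))

lemma measurableSet_confidenceFails (m ε : ℝ) (t : ℕ) (i : Fin N) (k : Fin K) :
    MeasurableSet {ω | ConfidenceFails G γ (run.arms ω) (run.greedies ω) (run.rewards ω)
      σ ξ m ε t i k} := by
  have h1 : Measurable fun ω => obsCount G γ (run.arms ω) (run.greedies ω) t i k :=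
    run.measurable_observedSum (f := fun _ => 1) measurable_const t i k
  have h2 := run.measurable_observedSum (f := fun x => x - m) (by fun_prop) t i k
  refine MeasurableSet.inter (h1 (measurableSet_singleton 0).compl) ?_
  exact measurableSet_le ((h1.const_mul _).sqrt.const_mul σ) (h2.const_mul ε)

/-- Fixing the random count to `n` permits a deterministic exponent. On the event the
supermartingale is at least exp(L/2), and Markov's inequality applies. -/
lemma measure_confidenceFails_count_le [IsProbabilityMeasure P] (hσ : 0 < σ) (hξ : 0 ≤ ξ)
    {k : Fin K} {m : ℝ} {c : ℝ≥0}
    (h : HasSubgaussianMGF (fun x => x - m) c (ν k)) (hc : (c : ℝ) ≤ σ ^ 2) {ε : ℝ}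
    (hε : ε ^ 2 = 1) (t : ℕ) (i : Fin N) {n : ℕ} (hn : 1 ≤ n) :
    P {ω | obsCount G γ (run.arms ω) (run.greedies ω) t i k = n ∧
      ConfidenceFails G γ (run.arms ω) (run.greedies ω) (run.rewards ω) σ ξ m ε t i k} ≤
      ENNReal.ofReal (Real.exp (-((ξ + 1) * Real.log t))) := by
  have hlog : 0 ≤ Real.log t := Real.log_natCast_nonneg t
  have hn' : (0 : ℝ) < n := by exact_mod_cast hn
  set L : ℝ := 2 * (ξ + 1) * Real.log t with hL
  have hL0 : 0 ≤ L := by positivity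
  -- The optimal Chernoff exponent for `n` observations; `ε` selects the tail.
  set l : ℝ := ε * √(L / n) / σ with hl
  have hlsq : l ^ 2 * σ ^ 2 = L / n := by
    rw [hl, div_pow, mul_pow, hε, Real.sq_sqrt (by positivity)]
    field_simp
  set f : Ω → ENNReal := fun ω => ENNReal.ofReal (Real.exp (∑ u ∈ Finset.range t, ∑ j,
    (run.observedEvent t i k u j).indicator
      (fun ω => l * (run.draw (u + 1) j k ω - m) - l ^ 2 * σ ^ 2 / 2) ω))
  have hf : ∫⁻ ω, f ω ∂P ≤ 1 := run.lintegral_exp_observed_le h hc l _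
    (run.measurableSet_observedEvent t i k) t
  have hexp : ∀ ω, ∑ u ∈ Finset.range t, ∑ j, (run.observedEvent t i k u j).indicator
      (fun ω => l * (run.draw (u + 1) j k ω - m) - l ^ 2 * σ ^ 2 / 2) ω =
      l * observedSum G γ (run.arms ω) (run.greedies ω) (fun u j => run.rewards ω u j - m) t i k -
        l ^ 2 * σ ^ 2 / 2 * obsCount G γ (run.arms ω) (run.greedies ω) t i k := by
    classical
    intro ω
    rw [run.observedSum_rewards_eq (fun x => x - m), obsCount_eq]
    simp only [Finset.mul_sum, ← Finset.sum_sub_distrib, Set.indicator_apply]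
    refine Finset.sum_congr rfl fun u _ => Finset.sum_congr rfl fun j _ => ?_
    split_ifs <;> simp
  have hfm : Measurable f := by
    simp only [f, hexp]
    have h1 : Measurable fun ω => obsCount G γ (run.arms ω) (run.greedies ω) t i k :=
      run.measurable_observedSum (f := fun _ => 1) measurable_const t i k
    have h2 := run.measurable_observedSum (f := fun x => x - m) (by fun_prop) t i k
    exact ((h2.const_mul l).sub (h1.const_mul _)).exp.ennreal_ofReal
  calc _ ≤ P {ω | ENNReal.ofReal (Real.exp (L / 2)) ≤ f ω} := by
        refine measure_mono fun ω hω => ?_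
        obtain ⟨hcount, -, hdev⟩ := hω
        rw [hcount] at hdev
        refine ENNReal.ofReal_le_ofReal (Real.exp_le_exp.2 ?_)
        rw [hexp, hcount, hlsq]
        set S := observedSum G γ (run.arms ω) (run.greedies ω)
          (fun u j => run.rewards ω u j - m) t i k
        have h1 : √(L / n) * √(L * n) = L := by
          rw [← Real.sqrt_mul (by positivity), show L / n * (L * n) = L * L by field_simp,
            Real.sqrt_mul_self hL0]
        have h2 : √(L / n) / σ * (σ * √(L * n)) ≤ √(L / n) / σ * (ε * S) := by gcongr
        have h3 : √(L / n) / σ * (σ * √(L * n)) = L := by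
          refine Eq.trans ?_ h1
          field_simp
        have h4 : l * S = √(L / n) / σ * (ε * S) := by rw [hl]; ring
        have h5 : L / n / 2 * n = L / 2 := by field_simp
        rw [h4, h5]
        linarith
    _ ≤ (∫⁻ ω, f ω ∂P) / ENNReal.ofReal (Real.exp (L / 2)) :=
        meas_ge_le_lintegral_div hfm.aemeasurable
          (ENNReal.ofReal_pos.2 (Real.exp_pos _)).ne' ENNReal.ofReal_ne_top
    _ ≤ 1 / ENNReal.ofReal (Real.exp (L / 2)) := by gcongr
    _ = _ := by
        rw [one_div, ← ENNReal.ofReal_inv_of_pos (Real.exp_pos _), ← Real.exp_neg, hL]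
        ring_nf

/-- The probability that a confidence bound fails. -/
lemma measureReal_confidenceFails_le [IsProbabilityMeasure P] (hσ : 0 < σ) (hξ : 0 ≤ ξ)
    {k : Fin K} {m : ℝ} {c : ℝ≥0}
    (h : HasSubgaussianMGF (fun x => x - m) c (ν k)) (hc : (c : ℝ) ≤ σ ^ 2) {ε : ℝ}
    (hε : ε ^ 2 = 1) {t : ℕ} (ht : 1 ≤ t) (i : Fin N) :
    P.real {ω | ConfidenceFails G γ (run.arms ω) (run.greedies ω) (run.rewards ω) σ ξ m ε t i k} ≤
      N * (t : ℝ) ^ (-ξ) := by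
  have ht' : (0 : ℝ) < t := by exact_mod_cast ht
  -- At most tN counts occur, each costing t^{-(ξ+1)}, whence N t^{-ξ}; count 0 is excluded by
  -- `ConfidenceFails`.
  have hsub : {ω | ConfidenceFails G γ (run.arms ω) (run.greedies ω) (run.rewards ω)
      σ ξ m ε t i k} ⊆ ⋃ n ∈ Finset.Icc 1 (t * N),
      {ω | obsCount G γ (run.arms ω) (run.greedies ω) t i k = (n : ℕ) ∧
        ConfidenceFails G γ (run.arms ω) (run.greedies ω) (run.rewards ω) σ ξ m ε t i k} := by
    intro ω hω
    obtain ⟨n, hn, hcount⟩ := run.exists_obsCount_eq t i k ω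
    have hn0 : n ≠ 0 := by
      rintro rfl
      exact hω.1 (by simpa using hcount)
    exact Set.mem_biUnion (show n ∈ (Finset.Icc 1 (t * N) : Set ℕ) by
      simp only [Finset.coe_Icc, Set.mem_Icc]; omega) ⟨hcount, hω⟩
  have hP := calc
    P {ω | ConfidenceFails G γ (run.arms ω) (run.greedies ω) (run.rewards ω) σ ξ m ε t i k}
      ≤ ∑ n ∈ Finset.Icc 1 (t * N), ENNReal.ofReal (Real.exp (-((ξ + 1) * Real.log t))) :=
        (measure_mono hsub).trans <| (measure_biUnion_finset_le _ _).trans <|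
          Finset.sum_le_sum fun n hn => run.measure_confidenceFails_count_le hσ hξ h hc hε t i
            (Finset.mem_Icc.1 hn).1
    _ = ENNReal.ofReal ((t * N : ℕ) * Real.exp (-((ξ + 1) * Real.log t))) := by
        rw [Finset.sum_const, nsmul_eq_mul, Nat.card_Icc, add_tsub_cancel_right,
          ENNReal.ofReal_mul (by positivity), ENNReal.ofReal_natCast]
  refine (ENNReal.toReal_le_of_le_ofReal (by positivity) hP).trans_eq ?_
  have : (t : ℝ) ^ (-ξ) = t * Real.exp (-((ξ + 1) * Real.log t)) := by
    rw [show -((ξ + 1) * Real.log t) = Real.log t * (-ξ - 1) by ring, ← Real.rpow_def_of_pos ht',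
      Real.rpow_sub_one ht'.ne']
    field_simp
  rw [this]
  push_cast
  ring

end ComExMPUCB

end Concentration

/-! ### Expected communication cost -/

/-- Comparison with an integral in telescoped form: 11 = 1 + 1/(1.1 - 1), and the majorant 11 - 10
n^{-1/10} equals 1 at n = 1. -/
lemma sum_rpow_neg_le {ξ : ℝ} (hξ : (11 / 10 : ℝ) ≤ ξ) (T : ℕ) :
    ∑ s ∈ Finset.Ico 1 T, (s : ℝ) ^ (-ξ) ≤ 11 := by
  have key : ∀ n : ℕ, ∑ s ∈ Finset.Ico 1 (n + 2), (s : ℝ) ^ (-(11 / 10) : ℝ) ≤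
      11 - 10 * ((n + 1 : ℕ) : ℝ) ^ (-(1 / 10) : ℝ) := by
    intro n
    induction n with
    | zero => norm_num
    | succ n ih =>
      rw [Finset.sum_Ico_succ_top (by omega)]
      set x : ℝ := ((n + 1 : ℕ) : ℝ) with hx
      have hx0 : 0 < x := by positivity
      rw [show ((n + 2 : ℕ) : ℝ) = x + 1 by rw [hx]; push_cast; ring]
      have hlog : 1 / (x + 1) ≤ Real.log (x + 1) - Real.log x := by
        have := Real.log_le_sub_one_of_pos (show 0 < x / (x + 1) by positivity)
        rw [Real.log_div hx0.ne' (by positivity)] at this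
        have e : x / (x + 1) - 1 = -(1 / (x + 1)) := by field_simp; ring
        linarith
      -- The telescoping step (x+1)^{-11/10} ≤ 10 (x^{-1/10} - (x+1)^{-1/10}), obtained from 1 + y ≤
      -- exp y.
      have h1 : (x + 1) ^ (-(1 / 10) : ℝ) * (1 + 1 / 10 * (1 / (x + 1))) ≤
          x ^ (-(1 / 10) : ℝ) := by
        rw [Real.rpow_def_of_pos hx0, Real.rpow_def_of_pos (by positivity : 0 < x + 1)]
        have h2 := Real.add_one_le_exp (1 / 10 * (Real.log (x + 1) - Real.log x))
        calc _ ≤ Real.exp (Real.log (x + 1) * -(1 / 10)) *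
              Real.exp (1 / 10 * (Real.log (x + 1) - Real.log x)) := by
              gcongr
              linarith
          _ = _ := by rw [← Real.exp_add]; ring_nf
      have h3 : (x + 1) ^ (-(11 / 10) : ℝ) = (x + 1) ^ (-(1 / 10) : ℝ) * (1 / (x + 1)) := by
        rw [show (-(11 / 10) : ℝ) = -(1 / 10) - 1 by norm_num, Real.rpow_sub_one (by positivity)]
        ring
      rw [h3]
      linarith
  have hmono : ∑ s ∈ Finset.Ico 1 T, (s : ℝ) ^ (-ξ) ≤
      ∑ s ∈ Finset.Ico 1 (T + 2), (s : ℝ) ^ (-(11 / 10) : ℝ) := by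
    refine (Finset.sum_le_sum fun s hs => ?_).trans
      (Finset.sum_le_sum_of_subset_of_nonneg (Finset.Ico_subset_Ico_right (by omega))
        fun s _ _ => by positivity)
    exact Real.rpow_le_rpow_of_exponent_le (by exact_mod_cast (Finset.mem_Ico.1 hs).1)
      (by linarith)
  have : (0 : ℝ) ≤ ((T + 1 : ℕ) : ℝ) ^ (-(1 / 10) : ℝ) := by positivity
  linarith [key T]

/-- Cover by singletons. Of the covering number only 1 ≤ χ̄ ≤ N is needed: the lower bound enlarges
coefficients 1 to χ̄, the upper one makes the term with N - χ̄ nonnegative. -/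
lemma cliqueCoverNumber_le {N : ℕ} (G : SimpleGraph (Fin N)) : cliqueCoverNumber G ≤ N :=
  Nat.sInf_le ⟨id, fun _ _ ha _ hb hab => (hab (Eq.trans ha (Eq.symm hb))).elim⟩

lemma one_le_cliqueCoverNumber {N : ℕ} (hN : 1 ≤ N) (G : SimpleGraph (Fin N)) :
    1 ≤ cliqueCoverNumber G := by
  obtain ⟨f, -⟩ := Nat.sInf_mem (s := {n : ℕ | ∃ f : Fin N → Fin n, ∀ c : Fin n,
    G.IsClique {v | f v = c}}) ⟨N, id, fun _ _ ha _ hb hab => (hab (Eq.trans ha (Eq.symm hb))).elim⟩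
  exact (Nat.zero_le _).trans_lt (f ⟨0, hN⟩).isLt

/-- Since log 3 ≥ 1, each summand is at least 12, and 7N + 12N = 19N. -/
lemma le_gFun {N : ℕ} (x : Fin N → ℝ) (hx : ∀ j, 0 ≤ x j) : 19 * N ≤ gFun (7 * (N : ℝ)) x := by
  have hlog3 : 1 ≤ Real.log 3 := by
    rw [Real.le_log_iff_exp_le (by norm_num)]
    linarith [Real.exp_one_lt_d9]
  have : ∑ _j : Fin N, (12 : ℝ) ≤
      ∑ j : Fin N, (12 * Real.log (3 * (x j + 1)) + 3 * Real.log (x j + 1)) := by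
    refine Finset.sum_le_sum fun j _ => ?_
    have h1 : 0 ≤ Real.log (x j + 1) := Real.log_nonneg (by linarith [hx j])
    rw [Real.log_mul (by norm_num) (by linarith [hx j])]
    linarith
  rw [Finset.sum_const, Finset.card_univ, Fintype.card_fin, nsmul_eq_mul] at this
  unfold gFun
  linarith

/-! ### Integrability and expectations of the trajectory bounds. -/

section Expectation

variable {N K : ℕ} {G : SimpleGraph (Fin N)} {γ : ℕ} {σ ξ : ℝ} {ν : Fin K → Measure ℝ}
  {Ω : Type*} [mΩ : MeasurableSpace Ω] {P : Measure Ω}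
  (run : ComExMPUCB G γ σ ξ ν P)

namespace ComExMPUCB

/-- The messages which are initiated along a trajectory. -/
abbrev inits (ω : Ω) : ℕ → Fin N → Prop := initiates (run.arms ω) (run.greedies ω)

lemma commCost_nonneg (T : ℕ) (ω : Ω) : 0 ≤ run.commCost T ω :=
  Finset.sum_nonneg fun _ _ => Finset.sum_nonneg fun _ _ => Nat.cast_nonneg _

lemma commCost_eq (hγ : 1 ≤ γ) (T : ℕ) (ω : Ω) :
    run.commCost T ω = ∑ i : Fin N, (((netState G γ (run.inits ω) T).sent i).card : ℝ) := by
  rw [commCost, Finset.sum_comm]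
  refine Finset.sum_congr rfl fun i _ => ?_
  rw [← sum_card_outbox G γ hγ]
  push_cast
  rfl

variable [IsProbabilityMeasure P]

lemma integrable_ite_inits (q : Prop) [Decidable q] (u : ℕ) (j : Fin N)
    [∀ ω, Decidable (run.inits ω (u + 1) j ∧ q)] :
    Integrable (fun ω => if run.inits ω (u + 1) j ∧ q then (1 : ℝ) else 0) P := by
  have hm : MeasurableSet {ω | run.inits ω (u + 1) j ∧ q} :=
    (run.info.le u _ (run.measurableSet_initiates u j)).inter (MeasurableSet.const q)
  refine ((integrable_const (1 : ℝ)).indicator hm).congr (ae_of_all _ fun ω => ?_)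
  simp [Set.indicator_apply]

lemma integrable_commCost (hγ : 1 ≤ γ) (T : ℕ) : Integrable (run.commCost T) P := by
  classical
  have : run.commCost T = fun ω => ∑ i : Fin N, ∑ j : Fin N, ∑ u ∈ Finset.range T,
      if run.inits ω (u + 1) j ∧ (j, u + 1) ∈ (netState G γ (fun _ _ => True) T).sent i
        then (1 : ℝ) else 0 := by
    ext ω
    rw [run.commCost_eq hγ]
    exact Finset.sum_congr rfl fun i _ => card_sent_eq G γ hγ _ i T
  rw [this]
  exact integrable_finsetSum _ fun i _ => integrable_finsetSum _ fun j _ =>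
    integrable_finsetSum _ fun u _ => run.integrable_ite_inits _ u j

lemma integrable_initCount (T : ℕ) (i : Fin N) :
    Integrable (fun ω => initCount (run.inits ω) T i) P := by
  classical
  unfold initCount
  refine integrable_finsetSum _ fun u _ => ?_
  simpa using run.integrable_ite_inits True u i

lemma integral_commCost_le (hγ : 1 ≤ γ) (T : ℕ) :
    ∫ ω, run.commCost T ω ∂P ≤ ∑ j : Fin N, ((powerDegree G (γ - 1) j : ℝ) + 1) *
      ∫ ω, initCount (run.inits ω) T j ∂P := by
  have hint : ∀ j ∈ Finset.univ, Integrable (fun ω => ((powerDegree G (γ - 1) j : ℝ) + 1) *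
      initCount (run.inits ω) T j) P := fun j _ => (run.integrable_initCount T j).const_mul _
  simp_rw [← integral_const_mul]
  rw [← integral_finsetSum _ hint]
  refine integral_mono (run.integrable_commCost hγ T) (integrable_finsetSum _ hint) fun ω => ?_
  simp only
  rw [run.commCost_eq hγ]
  exact sum_card_sent_le G γ hγ _ T

/-- The expected number of messages initiated by one agent. -/
lemma integral_initCount_le (hσ : 0 < σ) (hξ : (11 / 10 : ℝ) ≤ ξ) {μ : Fin K → ℝ}
    {v : Fin K → ℝ≥0} (hv : ∀ k, (v k : ℝ) ≤ σ ^ 2)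
    (hsub : ∀ k, HasSubgaussianMGF (fun x => x - μ k) (v k) (ν k)) {best : Fin K}
    (hK : 2 ≤ K) (hbest : ∀ k, k ≠ best → μ k < μ best) (T : ℕ) (i : Fin N) :
    ∫ ω, initCount (run.inits ω) T i ∂P ≤
      ∑ k, (8 * (ξ + 1) * σ ^ 2 / armGap μ best k ^ 2 * Real.log T + 1) + 11 * (N * K) := by
  classical
  set a : ℝ := ∑ k, (8 * (ξ + 1) * σ ^ 2 / armGap μ best k ^ 2 * Real.log T + 1)
  set F : ℕ → Fin K → Set Ω := fun s k => {ω | ConfidenceFails G γ (run.arms ω) (run.greedies ω)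
    (run.rewards ω) σ ξ (μ k) (errSign best k) s i k}
  have hF : ∀ s k, MeasurableSet (F s k) :=
    fun s k => run.measurableSet_confidenceFails _ _ s i k
  have hFint : ∀ s k, Integrable ((F s k).indicator (fun _ => (1 : ℝ))) P :=
    fun s k => (integrable_const _).indicator (hF s k)
  have hint2 : Integrable (fun ω => ∑ s ∈ Finset.Ico 1 T, ∑ k,
      (F s k).indicator (fun _ => (1 : ℝ)) ω) P :=
    integrable_finsetSum _ fun s _ => integrable_finsetSum _ fun k _ => hFint s k
  calc ∫ ω, initCount (run.inits ω) T i ∂P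
      ≤ ∫ ω, (a + ∑ s ∈ Finset.Ico 1 T, ∑ k, (F s k).indicator (fun _ => (1 : ℝ)) ω) ∂P := by
        refine integral_mono (run.integrable_initCount T i) ((integrable_const a).add hint2)
          fun ω => ?_
        have := initCount_le (G := G) (γ := γ) (A := run.arms ω) (B := run.greedies ω)
          (X := run.rewards ω) hσ (by linarith : 0 ≤ ξ) hK hbest (i := i)
          (fun s hs k => run.arm_max ω s i k hs) (fun s k => run.greedy_max ω s i k) T
        simpa only [Set.indicator_apply, F, Set.mem_ofPred_eq] using this
    _ = a + ∑ s ∈ Finset.Ico 1 T, ∑ k, P.real (F s k) := by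
        rw [integral_add (integrable_const a) hint2, integral_const, probReal_univ, one_smul,
          integral_finsetSum _ fun s _ => integrable_finsetSum _ fun k _ => hFint s k]
        congr 1
        refine Finset.sum_congr rfl fun s _ => ?_
        rw [integral_finsetSum _ fun k _ => hFint s k]
        refine Finset.sum_congr rfl fun k _ => ?_
        rw [integral_indicator_const _ (hF s k), smul_eq_mul, mul_one]
    _ ≤ a + ∑ s ∈ Finset.Ico 1 T, ∑ _k : Fin K, N * (s : ℝ) ^ (-ξ) := by
        gcongr with s hs k
        refine run.measureReal_confidenceFails_le hσ (by linarith) (hsub k) (hv k) ?_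
          (Finset.mem_Ico.1 hs).1 i
        unfold errSign
        split_ifs <;> norm_num
    _ = a + N * K * ∑ s ∈ Finset.Ico 1 T, (s : ℝ) ^ (-ξ) := by
        rw [Finset.mul_sum]
        congr 1
        refine Finset.sum_congr rfl fun s _ => ?_
        rw [Finset.sum_const, Finset.card_univ, Fintype.card_fin, nsmul_eq_mul]
        ring
    _ ≤ a + 11 * (N * K) := by
        rw [mul_comm (11 : ℝ)]
        gcongr
        exact sum_rpow_neg_le hξ T

end ComExMPUCB

end Expectation

/-! ### Assembly of the bound. -/

theorem theorem4 {N K : ℕ} (hK : 2 ≤ K)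
    (G : SimpleGraph (Fin N)) (γ : ℕ) (hγ : 1 ≤ γ)
    (σ ξ : ℝ) (hσ : 0 < σ) (hξ : (11 / 10 : ℝ) ≤ ξ)
    (ν : Fin K → Measure ℝ) [∀ k, IsProbabilityMeasure (ν k)]
    (μ : Fin K → ℝ) (hμ : ∀ k, μ k = ∫ x, x ∂(ν k))
    (v : Fin K → ℝ≥0) (hv : ∀ k, (v k : ℝ) ≤ σ ^ 2)
    (hsub : ∀ k, HasSubgaussianMGF (fun x => x - μ k) (v k) (ν k))
    (best : Fin K) (hbest : ∀ k, k ≠ best → μ k < μ best)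
    {Ω : Type*} [MeasurableSpace Ω] (P : Measure Ω) [IsProbabilityMeasure P]
    (run : ComExMPUCB G γ σ ξ ν P) :
    (∀ T : ℕ, 1 ≤ T →
      Integrable (run.commCost T) P ∧
      ∫ ω, run.commCost T ω ∂P ≤
        mainTerm G γ σ ξ μ best T +
          (K : ℝ) * ∑ i : Fin N, ((powerDegree G (γ - 1) i : ℝ) + 1) *
            gFun (7 * (N : ℝ)) (fun _ : Fin N => (powerDegree G γ i : ℝ)) ∧
      ∫ ω, run.commCost T ω ∂P ≤
        mainTerm G γ σ ξ μ best T +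
          (K : ℝ) * (∑ i : Fin N, ((powerDegree G (γ - 1) i : ℝ) + 1)) *
            gFun (7 * (N : ℝ)) (fun j : Fin N => (powerDegree G γ j : ℝ))) ∧
    (fun T : ℕ => ∫ ω, run.commCost T ω ∂P) =O[Filter.atTop] (fun T : ℕ => Real.log (T : ℝ)) := by
  set d : Fin N → ℝ := fun i => (powerDegree G (γ - 1) i : ℝ) + 1 with hd
  have hd0 : ∀ i, 0 ≤ d i := fun i => by positivity
  set χ : ℝ := (cliqueCoverNumber (powerGraph G γ) : ℝ) with hχ
  set c : ℝ := 8 * (ξ + 1) * σ ^ 2 * ((N : ℝ) / minGap μ best ^ 2 +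
    ∑ k ∈ Finset.univ.erase best, χ / (μ best - μ k) ^ 2) with hc
  set e : ℝ := (K : ℝ) * (((N : ℝ) - χ) * ((γ : ℝ) - 1)) with he
  have hmain : ∀ T : ℕ, mainTerm G γ σ ξ μ best T = (c * Real.log T + e) * ∑ i, d i := by
    intro T
    rfl
  have hagent : ∀ (T : ℕ) (i : Fin N), ∫ ω, initCount (run.inits ω) T i ∂P ≤
      (c * Real.log T + e) + K * (19 * N) := by
    intro T i
    -- The existence of an agent `i` gives this; with no agents the sums over agents are empty.
    have hN : 1 ≤ N := Nat.one_le_of_lt i.pos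
    have hN' : (1 : ℝ) ≤ N := by exact_mod_cast hN
    have hχ1 : 1 ≤ χ := Nat.one_le_cast.2 (one_le_cliqueCoverNumber hN _)
    have hχN : χ ≤ N := Nat.cast_le.2 (cliqueCoverNumber_le _)
    have he0 : 0 ≤ e := by
      have : (1 : ℝ) ≤ γ := by exact_mod_cast hγ
      exact mul_nonneg (by positivity) (mul_nonneg (by linarith) (by linarith))
    have hlog : 0 ≤ Real.log T := Real.log_natCast_nonneg T
    -- The best arm contributes the smallest-gap term with coefficient 1 ≤ N, every other arm its
    -- own gap term with 1 ≤ χ.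
    have hsum : ∑ k, 8 * (ξ + 1) * σ ^ 2 / armGap μ best k ^ 2 ≤ c := by
      rw [← Finset.add_sum_erase _ _ (Finset.mem_univ best), hc,
        mul_add (8 * (ξ + 1) * σ ^ 2), Finset.mul_sum]
      have hξ0 : 0 ≤ ξ + 1 := by linarith
      refine add_le_add ?_ (Finset.sum_le_sum fun k hk => ?_)
      · rw [armGap, if_pos rfl, div_eq_mul_one_div]
        gcongr
      · rw [armGap, if_neg (Finset.ne_of_mem_erase hk), div_eq_mul_one_div]
        gcongr
    have h := run.integral_initCount_le hσ hξ hv hsub hK hbest T i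
    rw [Finset.sum_add_distrib, ← Finset.sum_mul] at h
    simp only [Finset.sum_const, Finset.card_univ, Fintype.card_fin, nsmul_eq_mul, mul_one] at h
    have h1 := mul_le_mul_of_nonneg_right hsum hlog
    have h2 : (K : ℝ) * 1 ≤ K * N := by gcongr
    -- The remaining constant K + 11NK is at most 12NK, below the available 19NK.
    have h3 : 0 ≤ (K : ℝ) * N := by positivity
    linarith
  have htotal : ∀ T : ℕ, ∫ ω, run.commCost T ω ∂P ≤
      (c * Real.log T + e) * ∑ i, d i + K * ∑ i, d i * (19 * N) := by
    intro T
    refine (run.integral_commCost_le hγ T).trans ?_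
    rw [Finset.mul_sum, Finset.mul_sum, ← Finset.sum_add_distrib]
    refine Finset.sum_le_sum fun i _ => ?_
    calc d i * _ ≤ d i * ((c * Real.log T + e) + K * (19 * N)) := by
          exact mul_le_mul_of_nonneg_left (hagent T i) (hd0 i)
      _ = _ := by ring
  refine ⟨fun T _ => ⟨run.integrable_commCost hγ T, (htotal T).trans ?_, (htotal T).trans ?_⟩, ?_⟩
  · rw [hmain]
    gcongr with i
    exact le_gFun _ fun _ => by positivity
  · rw [hmain, ← Finset.sum_mul, mul_assoc (K : ℝ)]
    gcongr
    exact le_gFun _ fun _ => by positivity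
  · have hlogtop : Filter.Tendsto (fun T : ℕ => Real.log (T : ℝ)) Filter.atTop Filter.atTop :=
      Real.tendsto_log_atTop.comp tendsto_natCast_atTop_atTop
    have hO : (fun T : ℕ => (c * Real.log T + e) * ∑ i, d i + K * ∑ i, d i * (19 * N))
        =O[Filter.atTop] (fun T : ℕ => Real.log (T : ℝ)) := by
      -- Constants are negligible because log T tends to infinity.
      have hconst : ∀ b : ℝ, (fun _ : ℕ => b) =O[Filter.atTop] (fun T : ℕ => Real.log (T : ℝ)) :=
        fun b => (Asymptotics.isLittleO_const_left.2
          (Or.inr (Filter.tendsto_abs_atTop_atTop.comp hlogtop))).isBigO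
      have hlin : (fun T : ℕ => (∑ i, d i) * (c * Real.log T + e)) =O[Filter.atTop]
          (fun T : ℕ => Real.log (T : ℝ)) :=
        (((Asymptotics.isBigO_refl _ _).const_mul_left c).add (hconst e)).const_mul_left _
      refine (hlin.add (hconst (K * ∑ i, d i * (19 * N)))).congr_left fun T => ?_
      rw [mul_comm (∑ i, d i)]
    refine Asymptotics.IsBigO.trans (Asymptotics.IsBigO.of_norm_le fun T => ?_) hO
    rw [Real.norm_of_nonneg (integral_nonneg fun ω => run.commCost_nonneg T ω)]
    exact htotal T
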